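/- Consider a linear multihop path of $N\ge 1$ hops and length $L>0$ in the plane: the nodes $A_1,\dots,A_{N+1}$ lie equidistantly on a segment of length $L$, and $A_n$ transmits to $A_{n+1}$ in hop $n$, with power $p>0$. In hop $n$ the eavesdroppers form a homogeneous Poisson point process $\Phi_n$ of density $\lambda_e>0$ in $\mathbb{R}^2$, and $\Phi_1,\dots,\Phi_N$ are independent. All power fading gains, $H_n$ of the link $A_nA_{n+1}$ and $S_{ne}$ of the link from $A_n$ to the eavesdropper $e\in\Phi_n$, are exponentially distributed with mean $1$, independent of one another and of the eavesdroppers' locations (Rayleigh fading). With path loss $1/(1+r^\alpha)$, $\alpha>0$, and unit noise power, the received signal-to-noise ratios are $$\mathrm{SNR}_n=\frac{pH_n}{|A_nA_{n+1}|^\alpha+1},\qquad \mathrm{SNR}_{ne}=\frac{pS_{ne}}{|A_ne|^\alpha+1}\quad(e\in\Phi_n).$$ Let $R_t$ be the rate of the codewords and $R_s<R_t$ the rate of the confidential information, and put $\beta_t=2^{R_t}-1$ and $\beta_e=2^{R_t-R_s}-1$. Under randomize-and-forward relaying (independent codewords in different hops) with non-cooperating eavesdroppers, a secrecy outage is the event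 $\max_{1\le n\le N}\sup_{e\in\Phi_n}\mathrm{SNR}_{ne}>\beta_e$. The end-to-end secrecy outage probability is the probability of this event, $$\mathcal{P}_{\mathrm{so}}=\mathbb{P}\Bigl(\max_{1\le n\le N}\sup_{e\in\Phi_n}\mathrm{SNR}_{ne}>\beta_e\Bigr),$$ and for a transmission scheme it is the conditional probability of this event given that all hops transmit. In non-on-off transmission (NOFT) every hop always transmits; in on-off transmission (OFT) hop $n$ transmits if and only if $\mathrm{SNR}_n>\beta_t$. **Theorem.** The unconditional probability $\mathcal{P}_{\mathrm{so}}$, and likewise the end-to-end secrecy outage probability under NOFT and under OFT, are equal to $$1-\exp\Bigl[-N K_1\Bigl(\frac{\beta_e}{p}\Bigr)^{-2/\alpha}e^{-\beta_e/p}\Bigr],\qquad K_1=\pi\lambda_e\,\Gamma\Bigl(\frac{2}{\alpha}+1\Bigr),$$ where $\Gamma$ is the gamma function. -/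

import Mathlib

open MeasureTheory ProbabilityTheory
open scoped NNReal ENNReal

namespace MultihopRaF

noncomputable section

/-- The Euclidean plane. -/
abbrev Plane : Type := EuclideanSpace ℝ (Fin 2)

/-- Number of points of the (enumerated) configuration `x` that lie in `B`. -/
def pointCount (x : ℕ → Plane) (B : Set Plane) : ℕ∞ := {k : ℕ | x k ∈ B}.encard

/-- The random points `X 0, X 1, …` enumerate a homogeneous Poisson point process of density `lam`
in the plane: the number of points in a Borel set `B` of finite area is Poisson distributed with
mean `lam * area B`, and the numbers of points in pairwise disjoint Borel sets are independent.
(For `lam > 0` such a process has almost surely infinitely many points, so enumerating its points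
by `ℕ` is no restriction.) -/
structure IsHomogeneousPPP {Ω : Type*} [MeasurableSpace Ω] (P : Measure Ω)
    (X : ℕ → Ω → Plane) (lam : ℝ) : Prop where
  measurable : ∀ k, Measurable (X k)
  count_law : ∀ B : Set Plane, MeasurableSet B → volume B < ∞ → ∀ j : ℕ,
    P {ω | pointCount (fun k => X k ω) B = (j : ℕ∞)}
      = poissonMeasure (lam * (volume B).toReal).toNNReal {j}
  indep_counts : ∀ (m : ℕ) (B : Fin m → Set Plane), (∀ i, MeasurableSet (B i)) →
    Pairwise (fun i j => Disjoint (B i) (B j)) →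
    iIndepFun (fun i ω => pointCount (fun k => X k ω) (B i)) P

/-- Deterministic parameters of a linear multihop network. -/
structure Params where
  /-- number of hops `N` -/
  N : ℕ
  /-- source-destination distance `L` -/
  L : ℝ
  /-- path loss exponent `α` -/
  alpha : ℝ
  /-- transmit power `p` (the noise power is normalized to one) -/
  p : ℝ
  /-- density `λ_e` of the eavesdroppers -/
  lam : ℝ
  /-- rate `R_t` of the transmitted codewords -/
  Rt : ℝ
  /-- rate `R_s` of the confidential information -/
  Rs : ℝ

namespace Params

/-- SNR threshold for decoding at the legitimate receiver, `β_t = 2 ^ R_t - 1`. -/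
def betaT (c : Params) : ℝ := (2 : ℝ) ^ c.Rt - 1

/-- SNR threshold for secrecy outage, `β_e = 2 ^ R_e - 1` with `R_e = R_t - R_s`. -/
def betaE (c : Params) : ℝ := (2 : ℝ) ^ (c.Rt - c.Rs) - 1

/-- `K₁ = π λ_e Γ(2/α + 1)`. -/
def K₁ (c : Params) : ℝ := Real.pi * c.lam * Real.Gamma (2 / c.alpha + 1)

/-- Position of the `i`-th node, `i = 0, …, N`: the nodes are equidistant on a segment of
length `L`, node `0` is the source and node `N` the destination. -/
def node (c : Params) (i : ℕ) : Plane := !₂[(i : ℝ) * (c.L / c.N), 0]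

/-- Received SNR over a channel with power fading gain `g` between points `a` and `b`, with
transmit power `p` and path loss `1 / (1 + r ^ α)` at distance `r`. -/
def snr (c : Params) (g : ℝ) (a b : Plane) : ℝ := c.p * g / (dist a b ^ c.alpha + 1)

end Params

/-- The random quantities of the network. Hop `n : Fin N` goes from node `n` to node `n + 1`. -/
structure Channels (c : Params) (Ω : Type*) where
  /-- `X n k` is the location of the `k`-th eavesdropper during hop `n` -/
  X : Fin c.N → ℕ → Ω → Plane
  /-- `S n k` is the power fading gain between the transmitter of hop `n` and the `k`-th
  eavesdropper of hop `n` -/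
  S : Fin c.N → ℕ → Ω → ℝ
  /-- `H n` is the power fading gain of the legitimate link of hop `n` -/
  H : Fin c.N → Ω → ℝ

namespace Channels

variable {c : Params} {Ω : Type*}

/-- All power fading gains, of the legitimate links and of the eavesdropping links. -/
def gains (M : Channels c Ω) : Fin c.N ⊕ (Fin c.N × ℕ) → Ω → ℝ :=
  Sum.elim M.H (fun i => M.S i.1 i.2)

/-- The stochastic model: in the different hops the eavesdroppers form independent homogeneous
Poisson point processes of density `λ_e`; all power fading gains are independent and exponentially
distributed with unit mean (Rayleigh fading), and independent of the eavesdroppers' locations. -/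
structure IsModel [MeasurableSpace Ω] (M : Channels c Ω) (P : Measure Ω) : Prop where
  ppp : ∀ n, IsHomogeneousPPP P (M.X n) c.lam
  indep_hops : iIndepFun (fun n ω k => M.X n k ω) P
  measurable_gains : ∀ i, Measurable (M.gains i)
  law_gains : ∀ i, P.map (M.gains i) = expMeasure 1
  indep_gains : iIndepFun M.gains P
  indep_locations_gains : IndepFun (fun ω n k => M.X n k ω) (fun ω i => M.gains i ω) P

/-- SNR at the legitimate receiver of hop `n`. -/
def snrLegit (M : Channels c Ω) (n : Fin c.N) (ω : Ω) : ℝ :=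
  c.snr (M.H n ω) (c.node n.val) (c.node (n.val + 1))

/-- SNR at the `k`-th eavesdropper of hop `n`. -/
def snrEve (M : Channels c Ω) (n : Fin c.N) (k : ℕ) (ω : Ω) : ℝ :=
  c.snr (M.S n k ω) (c.node n.val) (M.X n k ω)

/-- Maximum SNR at the (non-cooperating) eavesdroppers of hop `n`, in the extended reals. -/
def snrEveMax (M : Channels c Ω) (n : Fin c.N) (ω : Ω) : EReal :=
  ⨆ k : ℕ, (M.snrEve n k ω : EReal)

/-- End-to-end secrecy outage: the maximum over the hops of the maximum SNR at the eavesdroppers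
exceeds `β_e`. (Under randomize-and-forward relaying the codewords of different hops are
independent, so the message is secure iff each hop is.) -/
def outage (M : Channels c Ω) : Set Ω := {ω | (c.betaE : EReal) < ⨆ n, M.snrEveMax n ω}

end Channels

/-- On-off transmission (with one-bit feedback) and non-on-off transmission (no feedback). -/
inductive Scheme
  | OFT
  | NOFT

/-- The event that all hops transmit. With on-off transmission a hop transmits only when the SNR at
its legitimate receiver exceeds `β_t`; without feedback every hop always transmits. -/
def transmission {c : Params} {Ω : Type*} (M : Channels c Ω) : Scheme → Set Ω
  | Scheme.OFT => {ω | ∀ n, c.betaT < M.snrLegit n ω}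
  | Scheme.NOFT => Set.univ

/-- End-to-end secrecy outage probability of a transmission scheme: the probability of a secrecy
outage given that the message is transmitted over all hops. -/
def secrecyOutageProb {c : Params} {Ω : Type*} [MeasurableSpace Ω] (P : Measure Ω)
    (M : Channels c Ω) (s : Scheme) : ℝ :=
  (cond P (transmission M s)).real M.outage

end

end MultihopRaF

/-! Given the locations, there is no outage iff every eavesdropper gain lies below a threshold `β_e
/ p * (d ^ α + 1)`, `d` being the distance to the transmitter. The conditional probability is a
product of exponential cdf values over all points, that is `exp (-∑ u (X k))` with `u = -log cdf`.
The Laplace functional of the Poisson process (`lintegral_expNeg_tsum`) averages this to `exp (-λ ∫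
(1 - cdf))`. The integrand is an exponential tail; polar coordinates evaluate it, and translation
invariance makes the result the same for every transmitter. Independent hops then give the factor
`N` in the exponent. The transmission events involve only the legitimate gains, which are
independent of the outage, so conditioning changes nothing (`measure_inter_compl_outage`). -/

namespace MultihopRaF

open Filter Topology

/-! ### Exponentials of sums in `[0, ∞]` -/

/-- The function `x ↦ exp (-x)` on `[0, ∞]`, with `exp (-∞) = 0`. -/
noncomputable def expNeg (x : ℝ≥0∞) : ℝ≥0∞ := EReal.exp (-(x : EReal))

lemma expNeg_zero : expNeg 0 = 1 := by simp [expNeg]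

lemma expNeg_add (x y : ℝ≥0∞) : expNeg (x + y) = expNeg x * expNeg y := by
  rw [expNeg, EReal.coe_ennreal_add, EReal.neg_add, sub_eq_add_neg, EReal.exp_add]
  · rfl
  · left; simp
  · right; simp

lemma expNeg_le_one (x : ℝ≥0∞) : expNeg x ≤ 1 := by
  simpa [expNeg] using EReal.coe_ennreal_nonneg x

lemma continuous_expNeg : Continuous expNeg :=
  (EReal.expHomeomorph.continuous.comp continuous_neg).comp continuous_coe_ennreal_ereal

lemma measurable_expNeg : Measurable expNeg := continuous_expNeg.measurable

lemma antitone_expNeg : Antitone expNeg := fun x y h => by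
  simpa [expNeg] using h

lemma expNeg_ofReal {x : ℝ} (hx : 0 ≤ x) :
    expNeg (ENNReal.ofReal x) = ENNReal.ofReal (Real.exp (-x)) := by
  rw [expNeg, EReal.coe_ennreal_ofReal, max_eq_left hx, ← EReal.coe_neg, EReal.exp_coe]

lemma expNeg_sum {ι : Type*} (s : Finset ι) (f : ι → ℝ≥0∞) :
    expNeg (∑ i ∈ s, f i) = ∏ i ∈ s, expNeg (f i) := by
  classical
  induction s using Finset.induction_on with
  | empty => simp [expNeg_zero]
  | insert a s ha ih => rw [Finset.sum_insert ha, Finset.prod_insert ha, expNeg_add, ih]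

/-- Continuity of `expNeg` up to `∞` lets the finite identity pass to the limit without any
convergence condition. -/
lemma expNeg_tsum {ι : Type*} (f : ι → ℝ≥0∞) :
    expNeg (∑' i, f i) = ∏' i, expNeg (f i) := by
  have h : HasProd (fun i => expNeg (f i)) (expNeg (∑' i, f i)) := by
    have := (continuous_expNeg.tendsto _).comp (ENNReal.summable (f := f)).hasSum
    simpa only [HasProd, Function.comp_def, expNeg_sum] using this
  exact h.tprod_eq.symm

lemma expNeg_mul_natCast (x : ℝ≥0∞) (n : ℕ) : expNeg (x * n) = expNeg x ^ n := by
  have := expNeg_sum (Finset.range n) (fun _ => x)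
  simpa [mul_comm] using this

/-- The Poisson generating function at `y = expNeg x`: the series sums to `exp (-r) * exp (r * y)`.
The case `x = ∞`, `y = 0` is included. -/
lemma lintegral_expNeg_mul_poissonMeasure (r : ℝ≥0) (x : ℝ≥0∞) :
    ∫⁻ n, expNeg (x * n) ∂(poissonMeasure r) = expNeg (r * (1 - expNeg x)) := by
  obtain ⟨y, hy⟩ : ∃ y : ℝ≥0, expNeg x = y :=
    ⟨_, (ENNReal.coe_toNNReal (ne_top_of_le_ne_top ENNReal.one_ne_top (expNeg_le_one x))).symm⟩
  have hy1 : (y : ℝ) ≤ 1 := by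
    have := expNeg_le_one x
    rw [hy] at this
    exact_mod_cast this
  have hsum : HasSum (fun n : ℕ => Real.exp (-r) * r ^ n / n.factorial * (y : ℝ) ^ n)
      (Real.exp (-r) * Real.exp (r * y)) := by
    have := (NormedSpace.expSeries_div_hasSum_exp ((r : ℝ) * y)).mul_left (Real.exp (-r))
    rw [← Real.exp_eq_exp_ℝ] at this
    refine this.congr_fun fun n => ?_
    rw [mul_pow]; ring
  have hR : (r : ℝ≥0∞) * (1 - expNeg x) = ENNReal.ofReal (r * (1 - y)) := by
    rw [hy, ENNReal.ofReal_mul r.coe_nonneg, ENNReal.ofReal_sub _ y.coe_nonneg]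
    simp
  rw [hR, expNeg_ofReal (mul_nonneg r.coe_nonneg (by linarith)), poissonMeasure,
    lintegral_sum_measure]
  simp_rw [lintegral_smul_measure, lintegral_dirac, expNeg_mul_natCast, hy, smul_eq_mul]
  have : ∀ n : ℕ, ENNReal.ofReal (Real.exp (-r) * r ^ n / n.factorial) * (y : ℝ≥0∞) ^ n
      = ENNReal.ofReal (Real.exp (-r) * r ^ n / n.factorial * (y : ℝ) ^ n) := fun n => by
    rw [ENNReal.ofReal_mul (by positivity), ENNReal.ofReal_pow y.coe_nonneg]
    simp
  simp_rw [this]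
  rw [← ENNReal.ofReal_tsum_of_nonneg (fun n => by positivity) hsum.summable, hsum.tsum_eq,
    ← Real.exp_add]
  congr 2; ring

/-! ### Laplace functional of the Poisson process -/

section PointProcess

variable {Ω : Type*} [MeasurableSpace Ω] {P : Measure Ω} {X : ℕ → Ω → Plane} {lam : ℝ}

lemma measurable_pointCount (hX : ∀ k, Measurable (X k)) {B : Set Plane} (hB : MeasurableSet B) :
    Measurable fun ω => pointCount (fun k => X k ω) B := by
  refine measurable_encard.comp (measurable_set_iff.2 fun k => ?_)
  exact measurable_mem.2 (hX k hB)

/-- The counting measure of a configuration counts its points. -/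
lemma sum_dirac_apply (x : ℕ → Plane) {B : Set Plane} (hB : MeasurableSet B) :
    Measure.sum (fun k => Measure.dirac (x k)) B = (pointCount x B : ℝ≥0∞) := by
  rw [Measure.sum_apply _ hB, pointCount, ← ENNReal.tsum_set_one,
    tsum_subtype {k | x k ∈ B} fun _ => (1 : ℝ≥0∞)]
  refine tsum_congr fun k => ?_
  rw [Measure.dirac_apply' _ hB]
  rfl

lemma lintegral_sum_dirac (x : ℕ → Plane) {u : Plane → ℝ≥0∞} (hu : Measurable u) :
    ∫⁻ a, u a ∂(Measure.sum fun k => Measure.dirac (x k)) = ∑' k, u (x k) := by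
  rw [lintegral_sum_measure]
  exact tsum_congr fun k => lintegral_dirac' _ hu

namespace IsHomogeneousPPP

variable [IsProbabilityMeasure P]

/-- `count_law` fixes the masses of the finite values; since both laws have total mass one, they
agree at `⊤` as well. -/
lemma map_pointCount (h : IsHomogeneousPPP P X lam) {B : Set Plane} (hB : MeasurableSet B)
    (hfin : volume B < ∞) :
    P.map (fun ω => pointCount (fun k => X k ω) B)
      = (poissonMeasure (lam * (volume B).toReal).toNNReal).map (Nat.cast : ℕ → ℕ∞) := by
  have hm := measurable_pointCount h.measurable hB
  have hc : Measurable (Nat.cast : ℕ → ℕ∞) := .of_discrete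
  have := Measure.isProbabilityMeasure_map (μ := P) hm.aemeasurable
  have := Measure.isProbabilityMeasure_map
    (μ := poissonMeasure (lam * (volume B).toReal).toNNReal) hc.aemeasurable
  have key : ∀ j : ℕ, P.map (fun ω => pointCount (fun k => X k ω) B) {(j : ℕ∞)}
      = (poissonMeasure (lam * (volume B).toReal).toNNReal).map (Nat.cast : ℕ → ℕ∞) {(j : ℕ∞)} := by
    intro j
    rw [Measure.map_apply hm (measurableSet_singleton _),
      Measure.map_apply hc (measurableSet_singleton _)]
    have e : (Nat.cast : ℕ → ℕ∞) ⁻¹' {(j : ℕ∞)} = {j} := by ext; simp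
    rw [e, ← h.count_law B hB hfin j]
    rfl
  refine Measure.ext_of_singleton fun n => ?_
  induction n using ENat.recTopCoe with
  | coe j => exact key j
  | top =>
    have e : ({⊤} : Set ℕ∞) = (⋃ j : ℕ, {(j : ℕ∞)})ᶜ := by
      ext n
      induction n using ENat.recTopCoe <;> simp
    have hd : Pairwise (Function.onFun Disjoint fun j : ℕ => ({(j : ℕ∞)} : Set ℕ∞)) :=
      fun i j hij => by simpa [Function.onFun] using hij
    have hms : ∀ j : ℕ, MeasurableSet ({(j : ℕ∞)} : Set ℕ∞) := fun j => measurableSet_singleton _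
    rw [e, prob_compl_eq_one_sub (MeasurableSet.iUnion hms),
      prob_compl_eq_one_sub (MeasurableSet.iUnion hms), measure_iUnion hd hms,
      measure_iUnion hd hms]
    simp_rw [key]

lemma lintegral_expNeg_mul_pointCount (h : IsHomogeneousPPP P X lam) (hlam : 0 ≤ lam)
    {B : Set Plane} (hB : MeasurableSet B) (hfin : volume B < ∞) (x : ℝ≥0∞) :
    ∫⁻ ω, expNeg (x * (pointCount (fun k => X k ω) B : ℝ≥0∞)) ∂P
      = expNeg (ENNReal.ofReal lam * ((1 - expNeg x) * volume B)) := by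
  have hm := measurable_pointCount h.measurable hB
  have hf : Measurable fun n : ℕ∞ => expNeg (x * (n : ℝ≥0∞)) := .of_discrete
  rw [← lintegral_map (f := fun n : ℕ∞ => expNeg (x * (n : ℝ≥0∞))) hf hm,
    h.map_pointCount hB hfin, lintegral_map hf .of_discrete]
  simp only [ENat.toENNReal_coe]
  rw [lintegral_expNeg_mul_poissonMeasure]
  congr 1
  rw [ENNReal.ofNNReal_toNNReal, ENNReal.ofReal_mul hlam, ENNReal.ofReal_toReal hfin.ne]
  ring

/-- Laplace functional of a Poisson point process at a simple function of finite support. -/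
lemma lintegral_expNeg_tsum_simpleFunc (h : IsHomogeneousPPP P X lam) (hlam : 0 ≤ lam)
    (φ : SimpleFunc Plane ℝ≥0∞) (hφ : ∀ c ≠ 0, volume (φ ⁻¹' {c}) < ∞) :
    ∫⁻ ω, expNeg (∑' k, φ (X k ω)) ∂P
      = expNeg (ENNReal.ofReal lam * ∫⁻ a, (1 - expNeg (φ a))) := by
  have hB : ∀ c, MeasurableSet (φ ⁻¹' {c}) := φ.measurableSet_fiber
  have hX : ∀ ω, ∑' k, φ (X k ω)
      = ∑ c ∈ φ.range, c * (pointCount (fun k => X k ω) (φ ⁻¹' {c}) : ℝ≥0∞) := by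
    intro ω
    rw [← lintegral_sum_dirac (fun k => X k ω) φ.measurable, SimpleFunc.lintegral_eq_lintegral,
      SimpleFunc.lintegral]
    simp_rw [sum_dirac_apply _ (hB _)]
  have hR : ∫⁻ a, (1 - expNeg (φ a)) = ∑ c ∈ φ.range, (1 - expNeg c) * volume (φ ⁻¹' {c}) := by
    rw [← SimpleFunc.map_lintegral (fun c => 1 - expNeg c) φ, ← SimpleFunc.lintegral_eq_lintegral]
    rfl
  -- The level sets of `φ` are pairwise disjoint, so their counts are independent.
  have hind := h.indep_counts φ.range.card (fun i => φ ⁻¹' {(φ.range.equivFin.symm i : ℝ≥0∞)})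
    (fun i => hB _) (fun i j hij => by
      refine Disjoint.preimage _ ?_
      simpa [Subtype.coe_inj] using hij)
  have hind' := hind.comp
    (fun i (n : ℕ∞) => expNeg ((φ.range.equivFin.symm i : ℝ≥0∞) * (n : ℝ≥0∞)))
    (fun i => .of_discrete)
  have hprod := lintegral_prod_eq_prod_lintegral_of_indepFun Finset.univ _ hind' (fun i =>
    Measurable.comp .of_discrete (measurable_pointCount h.measurable (hB _)))
  have reindex : ∀ g : ℝ≥0∞ → ℝ≥0∞,
      ∏ c ∈ φ.range, g c = ∏ i, g (φ.range.equivFin.symm i : ℝ≥0∞) := by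
    intro g
    rw [← Finset.prod_coe_sort, ← φ.range.equivFin.symm.prod_comp]
  simp_rw [hX, hR, expNeg_sum]
  rw [Finset.mul_sum, expNeg_sum, reindex]
  simp_rw [reindex]
  refine hprod.trans (Finset.prod_congr rfl fun i _ => ?_)
  simp only [Function.comp_apply]
  -- The zero level set may have infinite area, but both sides contribute the factor `1` there.
  by_cases hc : (φ.range.equivFin.symm i : ℝ≥0∞) = 0
  · simp [hc, expNeg_zero]
  · exact h.lintegral_expNeg_mul_pointCount hlam (hB _) (hφ _ hc) _

/-- Laplace functional of a homogeneous Poisson point process. -/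
theorem lintegral_expNeg_tsum (h : IsHomogeneousPPP P X lam) (hlam : 0 ≤ lam)
    {u : Plane → ℝ≥0∞} (hu : Measurable u) :
    ∫⁻ ω, expNeg (∑' k, u (X k ω)) ∂P
      = expNeg (ENNReal.ofReal lam * ∫⁻ a, (1 - expNeg (u a))) := by
  -- Cutting off to growing balls gives the nonzero level sets finite area and keeps the
  -- approximation monotone.
  let v : ℕ → SimpleFunc Plane ℝ≥0∞ := fun n =>
    (SimpleFunc.eapprox u n).restrict (Metric.ball 0 n)
  have hv_apply : ∀ n a, v n a = (Metric.ball 0 (n : ℝ)).indicator (SimpleFunc.eapprox u n) a :=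
    fun n a => SimpleFunc.restrict_apply _ Metric.isOpen_ball.measurableSet a
  have hv_mono : ∀ a, Monotone fun n => v n a := by
    intro a m n hmn
    simp only [hv_apply]
    refine Set.indicator_le_indicator_of_subset
      (Metric.ball_subset_ball (Nat.cast_le.2 hmn)) (fun _ => zero_le) a |>.trans ?_
    exact Set.indicator_le_indicator (SimpleFunc.monotone_eapprox u hmn a)
  have hv_lim : ∀ a, Tendsto (fun n => v n a) atTop (𝓝 (u a)) := by
    intro a
    refine (SimpleFunc.tendsto_eapprox hu a).congr' ?_
    filter_upwards [eventually_gt_atTop ⌈‖a‖⌉₊] with n hn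
    rw [hv_apply, Set.indicator_of_mem]
    simpa using Nat.lt_of_ceil_lt hn
  have hv_fin : ∀ n, ∀ c ≠ 0, volume (v n ⁻¹' {c}) < ∞ := by
    intro n c hc
    refine (measure_mono fun a ha => ?_).trans_lt (measure_ball_lt_top (x := (0 : Plane)) (r := n))
    by_contra hmem
    refine hc ?_
    rw [← (show v n a = c from ha), hv_apply, Set.indicator_of_notMem hmem]
  have lhs : Tendsto (fun n => ∫⁻ ω, expNeg (∑' k, v n (X k ω)) ∂P) atTop
      (𝓝 (∫⁻ ω, expNeg (∑' k, u (X k ω)) ∂P)) := by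
    refine tendsto_lintegral_of_dominated_convergence (fun _ => 1) (fun n => ?_)
      (fun n => ae_of_all _ fun ω => expNeg_le_one _) (by simp) (ae_of_all _ fun ω => ?_)
    · exact measurable_expNeg.comp
        (Measurable.tsum fun k => (v n).measurable.comp (h.measurable k))
    · refine (continuous_expNeg.tendsto _).comp ?_
      -- As integrals against counting measure, the sums over the points converge by monotone
      -- convergence.
      simp_rw [← lintegral_count]
      exact lintegral_tendsto_of_tendsto_of_monotone (fun n => .of_discrete)
        (ae_of_all _ fun k => hv_mono _) (ae_of_all _ fun k => hv_lim _)
  have rhs : Tendsto (fun n => expNeg (ENNReal.ofReal lam * ∫⁻ a, (1 - expNeg (v n a)))) atTop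
      (𝓝 (expNeg (ENNReal.ofReal lam * ∫⁻ a, (1 - expNeg (u a))))) := by
    refine (continuous_expNeg.tendsto _).comp
      (ENNReal.Tendsto.const_mul ?_ (Or.inr ENNReal.ofReal_ne_top))
    refine lintegral_tendsto_of_tendsto_of_monotone
      (fun n => (measurable_const.sub (measurable_expNeg.comp (v n).measurable)).aemeasurable)
      (ae_of_all _ fun a m n hmn => tsub_le_tsub_left (antitone_expNeg (hv_mono a hmn)) _)
      (ae_of_all _ fun a => ?_)
    exact ENNReal.Tendsto.sub tendsto_const_nhds ((continuous_expNeg.tendsto _).comp (hv_lim a))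
      (Or.inl ENNReal.one_ne_top)
  exact tendsto_nhds_unique lhs
    (rhs.congr fun n => (h.lintegral_expNeg_tsum_simpleFunc hlam (v n) (hv_fin n)).symm)

end IsHomogeneousPPP

end PointProcess

end MultihopRaF

/-! ### Exponential gains and the integral over the plane -/

namespace MultihopRaF

/-- Turns products of probabilities into exponentials of sums; `q = 0` corresponds to the exponent
`∞`. -/
lemma expNeg_neg_log {q : ℝ≥0∞} (hq : q ≤ 1) : expNeg (-ENNReal.log q).toENNReal = q := by
  have h0 : 0 ≤ -ENNReal.log q := by
    have := ENNReal.log_monotone hq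
    rw [ENNReal.log_one] at this
    simpa using EReal.neg_le_neg_iff.2 this
  rw [expNeg, EReal.coe_toENNReal h0, neg_neg, ENNReal.exp_log]

lemma expMeasure_Iic {x : ℝ} (hx : 0 ≤ x) :
    expMeasure 1 (Set.Iic x) = ENNReal.ofReal (1 - Real.exp (-x)) := by
  have := isProbabilityMeasure_expMeasure one_pos
  rw [← ofReal_cdf, cdf_expMeasure_eq one_pos, if_pos hx, one_mul]

/-- Keeps the conditioning event of on-off transmission non-null; `max x 0` covers negative
thresholds. -/
lemma expMeasure_Ioi_ne_zero (x : ℝ) : expMeasure 1 (Set.Ioi x) ≠ 0 := by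
  have := isProbabilityMeasure_expMeasure one_pos
  have hmax : expMeasure 1 (Set.Ioi (max x 0)) ≠ 0 := by
    rw [← Set.compl_Iic, prob_compl_eq_one_sub measurableSet_Iic,
      expMeasure_Iic (le_max_right _ _)]
    refine (tsub_pos_of_lt ?_).ne'
    rw [ENNReal.ofReal_lt_one]
    linarith [Real.exp_pos (-(max x 0))]
  exact fun h => hmax (measure_mono_null (Set.Ioi_subset_Ioi (le_max_left _ _)) h)

/-- Integral of a stretched exponential of the distance to a point of the plane. -/
lemma lintegral_exp_neg_mul_dist_rpow {b α : ℝ} (hb : 0 < b) (hα : 0 < α) (x₀ : Plane) :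
    ∫⁻ x : Plane, ENNReal.ofReal (Real.exp (-(b * dist x₀ x ^ α)))
      = ENNReal.ofReal (Real.pi * b ^ (-(2 / α)) * Real.Gamma (2 / α + 1)) := by
  have hint : ∫ x : Plane, Real.exp (-b * ‖x‖ ^ α)
      = Real.pi * b ^ (-(2 / α)) * Real.Gamma (2 / α + 1) := by
    rw [integral_fun_norm_addHaar volume fun r => Real.exp (-b * r ^ α)]
    -- The exponent `q = 1` is the polar weight `r ^ (2 - 1)` of the plane.
    have h1 := integral_rpow_mul_exp_neg_mul_rpow (p := α) (q := 1) hα (by norm_num) hb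
    have hball : (volume : Measure Plane).real (Metric.ball 0 1) = Real.pi := by
      rw [Measure.real, EuclideanSpace.volume_ball_fin_two]
      simp [Real.pi_pos.le]
    simp only [finrank_euclideanSpace, Fintype.card_fin, hball, smul_eq_mul, nsmul_eq_mul]
    norm_num at h1 ⊢
    rw [h1, Real.Gamma_add_one (by positivity), neg_div]
    ring
  have hpos : 0 < Real.pi * b ^ (-(2 / α)) * Real.Gamma (2 / α + 1) := by
    have := Real.Gamma_pos_of_pos (show 0 < 2 / α + 1 by positivity)
    have := Real.pi_pos
    positivity
  have hI : Integrable fun x : Plane => Real.exp (-b * ‖x‖ ^ α) :=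
    -- A non-integrable function has integral `0` by convention, so a nonzero integral forces
    -- integrability.
    not_imp_comm.1 integral_undef (by rw [hint]; exact hpos.ne')
  rw [← hint, ofReal_integral_eq_lintegral_ofReal hI (ae_of_all _ fun x => (Real.exp_pos _).le),
    ← lintegral_sub_right_eq_self (fun x => ENNReal.ofReal (Real.exp (-b * ‖x‖ ^ α))) x₀]
  simp_rw [dist_comm x₀, dist_eq_norm, neg_mul]

namespace Params

/-- Fading gains above this threshold make the SNR at `x` of a signal sent from `a` exceed `β`. -/
noncomputable def gainThreshold (c : Params) (β : ℝ) (a x : Plane) : ℝ :=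
  β / c.p * (dist a x ^ c.alpha + 1)

lemma snr_le_iff (c : Params) (hp : 0 < c.p) (β g : ℝ) (a x : Plane) :
    c.snr g a x ≤ β ↔ g ≤ c.gainThreshold β a x := by
  have h : 0 < dist a x ^ c.alpha + 1 := by positivity
  rw [snr, gainThreshold, div_le_iff₀ h, div_mul_eq_mul_div, le_div_iff₀ hp, mul_comm c.p]

lemma betaE_pos (c : Params) (hR : c.Rs < c.Rt) : 0 < c.betaE :=
  sub_pos.2 (Real.one_lt_rpow (by norm_num) (sub_pos.2 hR))

lemma measurable_gainThreshold (c : Params) (β : ℝ) (a : Plane) :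
    Measurable (c.gainThreshold β a) := by
  unfold gainThreshold
  fun_prop

/-- Mean number, divided by the density, of eavesdroppers of a hop that cause an outage. -/
lemma lintegral_one_sub_expMeasure (c : Params) (hα : 0 < c.alpha) {β : ℝ} (hβ : 0 < β)
    (hp : 0 < c.p) (a : Plane) :
    ∫⁻ x, (1 - expMeasure 1 (Set.Iic (c.gainThreshold β a x)))
      = ENNReal.ofReal (Real.pi * Real.Gamma (2 / c.alpha + 1) * (β / c.p) ^ (-(2 / c.alpha))
          * Real.exp (-(β / c.p))) := by
  have hb : 0 < β / c.p := div_pos hβ hp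
  have h : ∀ x, 1 - expMeasure 1 (Set.Iic (c.gainThreshold β a x))
      = ENNReal.ofReal (Real.exp (-(β / c.p)))
        * ENNReal.ofReal (Real.exp (-(β / c.p * dist a x ^ c.alpha))) := by
    intro x
    have h0 : 0 ≤ c.gainThreshold β a x := by unfold gainThreshold; positivity
    have h1 : Real.exp (-(c.gainThreshold β a x)) ≤ 1 := Real.exp_le_one_iff.2 (by linarith)
    rw [expMeasure_Iic h0, ← ENNReal.ofReal_one, ← ENNReal.ofReal_sub _ (by linarith),
      ← ENNReal.ofReal_mul (Real.exp_pos _).le, ← Real.exp_add, gainThreshold]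
    congr 1
    rw [sub_sub_cancel]
    congr 1; ring
  simp_rw [h]
  rw [lintegral_const_mul' _ _ ENNReal.ofReal_ne_top, lintegral_exp_neg_mul_dist_rpow hb hα,
    ← ENNReal.ofReal_mul (Real.exp_pos _).le]
  congr 1; ring

end Params

/-! ### Outage in the network, conditionally on the locations -/

namespace Channels

variable {c : Params} {Ω : Type*} (M : Channels c Ω)

lemma compl_outage : M.outageᶜ = {ω | ∀ n k, M.snrEve n k ω ≤ c.betaE} := by
  ext ω
  simp [outage, snrEveMax, iSup_le_iff]

lemma compl_outage_eq (hp : 0 < c.p) :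
    M.outageᶜ = {ω | ∀ n k, M.S n k ω ∈
      Set.Iic (c.gainThreshold c.betaE (c.node n.val) (M.X n k ω))} := by
  simp only [compl_outage, snrEve, c.snr_le_iff hp, Set.mem_Iic]

variable {M} [MeasurableSpace Ω] {P : Measure Ω}

lemma IsModel.measurable_S (hM : M.IsModel P) (n : Fin c.N) (k : ℕ) : Measurable (M.S n k) :=
  hM.measurable_gains (Sum.inr (n, k))

lemma IsModel.measurable_H (hM : M.IsModel P) (n : Fin c.N) : Measurable (M.H n) :=
  hM.measurable_gains (Sum.inl n)

lemma IsModel.measurableSet_outage (hM : M.IsModel P) (hp : 0 < c.p) :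
    MeasurableSet M.outage := by
  rw [← MeasurableSet.compl_iff, compl_outage_eq M hp]
  simp only [Set.mem_Iic, Set.ofPred_forall]
  exact .iInter fun n => .iInter fun k => measurableSet_le (hM.measurable_S n k)
    ((c.measurable_gainThreshold _ _).comp ((hM.ppp n).measurable k))

lemma IsModel.measure_forall_H_mem (hM : M.IsModel P) {T : Fin c.N → Set ℝ}
    (hT : ∀ n, MeasurableSet (T n)) :
    P {ω | ∀ n, M.H n ω ∈ T n} = ∏ n, expMeasure 1 (T n) := by
  have hind : iIndepFun M.H P := hM.indep_gains.precomp (g := Sum.inl) Sum.inl_injective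
  have := hind.measure_inter_preimage_eq_mul Finset.univ (sets := T) (fun n _ => hT n)
  simp only [Finset.mem_univ, Set.iInter_true] at this
  rw [Set.ofPred_forall]
  refine this.trans (Finset.prod_congr rfl fun n _ => ?_)
  rw [← hM.law_gains (Sum.inl n), Measure.map_apply (hM.measurable_gains _) (hT n)]
  rfl

/-- Joint probability of an event of the legitimate links and of the absence of strong
eavesdroppers, where the strength thresholds are functions of the eavesdroppers' locations. -/
lemma IsModel.measure_forall_H_mem_and_forall_S_mem [IsProbabilityMeasure P] (hM : M.IsModel P)
    (hlam : 0 ≤ c.lam)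
    {T : Fin c.N → Set ℝ} (hT : ∀ n, MeasurableSet (T n)) {f : Fin c.N → Plane → ℝ}
    (hf : ∀ n, Measurable (f n)) :
    P {ω | (∀ n, M.H n ω ∈ T n) ∧ ∀ n k, M.S n k ω ∈ Set.Iic (f n (M.X n k ω))}
      = (∏ n, expMeasure 1 (T n))
        * ∏ n, expNeg (ENNReal.ofReal c.lam * ∫⁻ x, (1 - expMeasure 1 (Set.Iic (f n x)))) := by
  have := isProbabilityMeasure_expMeasure one_pos
  let t : Fin c.N → ℝ≥0∞ := fun n => (-ENNReal.log (expMeasure 1 (T n))).toENNReal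
  have ht : ∀ n, expNeg (t n) = expMeasure 1 (T n) := fun n => expNeg_neg_log prob_le_one
  let u : Fin c.N → Plane → ℝ≥0∞ := fun n x =>
    (-ENNReal.log (expMeasure 1 (Set.Iic (f n x)))).toENNReal
  have hu : ∀ n x, expNeg (u n x) = expMeasure 1 (Set.Iic (f n x)) := fun n x =>
    expNeg_neg_log prob_le_one
  have hu_meas : ∀ n, Measurable (u n) := fun n =>
    (ENNReal.measurable_log.comp (Monotone.measurable (f := fun r => expMeasure 1 (Set.Iic r))
      (fun r s h => measure_mono (Set.Iic_subset_Iic.2 h)) |>.comp (hf n))).neg.ereal_toENNReal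
  let Y : Ω → Fin c.N → ℕ → Plane := fun ω n k => M.X n k ω
  let G : Ω → Fin c.N ⊕ (Fin c.N × ℕ) → ℝ := fun ω i => M.gains i ω
  have hY : Measurable Y :=
    measurable_pi_lambda _ fun n => measurable_pi_lambda _ fun k => (hM.ppp n).measurable k
  have hG : Measurable G := measurable_pi_lambda _ hM.measurable_gains
  let A : (Fin c.N → ℕ → Plane) → Fin c.N ⊕ (Fin c.N × ℕ) → Set ℝ := fun y =>
    Sum.elim T fun i => Set.Iic (f i.1 (y i.1 i.2))
  have hA : ∀ y i, MeasurableSet (A y i) := by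
    rintro y (n | i)
    · exact hT n
    · exact measurableSet_Iic
  let E : Set ((Fin c.N → ℕ → Plane) × (Fin c.N ⊕ (Fin c.N × ℕ) → ℝ)) :=
    {q | ∀ i, q.2 i ∈ A q.1 i}
  have hE : MeasurableSet E := by
    refine MeasurableSet.congr (s := ⋂ i, {q | q.2 i ∈ A q.1 i}) (.iInter ?_) (by ext; simp [E])
    rintro (n | i)
    · exact ((measurable_pi_apply _).comp measurable_snd) (hT n)
    · exact measurableSet_le ((measurable_pi_apply _).comp measurable_snd)
        ((hf i.1).comp ((measurable_pi_apply i.2).comp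
          ((measurable_pi_apply i.1).comp measurable_fst)))
  have hpre : {ω | (∀ n, M.H n ω ∈ T n) ∧ ∀ n k, M.S n k ω ∈ Set.Iic (f n (M.X n k ω))}
      = (fun ω => (Y ω, G ω)) ⁻¹' E := by
    ext ω
    simp [E, A, Y, G, gains, Sum.forall, Prod.forall]
  have hlaw : P.map G = Measure.infinitePi fun _ => expMeasure 1 := by
    have := hM.indep_gains.map_fun_eq_infinitePi_map₀ hG.aemeasurable
    simpa only [hM.law_gains] using this
  -- For fixed locations `y` the event is a box in gain space, so its probability is an infinite
  -- product.
  have hfib : ∀ y, (Measure.infinitePi fun _ => expMeasure 1) (Prod.mk y ⁻¹' E)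
      = (∏ n, expMeasure 1 (T n)) * ∏ n, expNeg (∑' k, u n (y n k)) := by
    intro y
    have e : Prod.mk y ⁻¹' E = Set.univ.pi (A y) := by ext g; simp [E]
    have e' : ∀ i, expMeasure 1 (A y i)
        = expNeg (Sum.elim t (fun i => u i.1 (y i.1 i.2)) i) := by
      rintro (n | i)
      · exact (ht n).symm
      · exact (hu _ _).symm
    rw [e, Measure.infinitePi_pi_univ _ (hA y)]
    simp_rw [e', ← ht]
    rw [← expNeg_tsum, Summable.tsum_sum ENNReal.summable ENNReal.summable, expNeg_add]
    simp only [Sum.elim_inl, Sum.elim_inr]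
    rw [ENNReal.tsum_prod', tsum_fintype, tsum_fintype, expNeg_sum, expNeg_sum]
  -- Locations and gains are independent, so their joint law is a product and Fubini applies.
  rw [hpre, ← Measure.map_apply (hY.prodMk hG) hE,
    hM.indep_locations_gains.map_prod_eq_prod_map_map hY.aemeasurable hG.aemeasurable, hlaw,
    Measure.prod_apply hE]
  simp_rw [hfib]
  have hW : ∀ n, Measurable fun z : ℕ → Plane => expNeg (∑' k, u n (z k)) := fun n =>
    measurable_expNeg.comp (Measurable.tsum fun k => (hu_meas n).comp (measurable_pi_apply k))
  have hmeas : Measurable fun y : Fin c.N → ℕ → Plane => ∏ n, expNeg (∑' k, u n (y n k)) :=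
    Finset.measurable_prod _ fun n _ => (hW n).comp (measurable_pi_apply n)
  rw [lintegral_const_mul _ hmeas, lintegral_map hmeas hY]
  congr 1
  have hind := hM.indep_hops.comp (fun n (z : ℕ → Plane) => expNeg (∑' k, u n (z k))) hW
  refine (lintegral_prod_eq_prod_lintegral_of_indepFun Finset.univ _ hind fun n =>
    (hW n).comp (measurable_pi_lambda _ fun k => (hM.ppp n).measurable k)).trans
    (Finset.prod_congr rfl fun n _ => ?_)
  simp_rw [← hu]
  exact (hM.ppp n).lintegral_expNeg_tsum hlam (hu_meas n)

/-- The legitimate gains split off as a factor; the remaining factors are equal for all hops and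
multiply to an `N`-th power. -/
lemma IsModel.measure_inter_compl_outage [IsProbabilityMeasure P] (hM : M.IsModel P)
    (hα : 0 < c.alpha) (hp : 0 < c.p) (hlam : 0 ≤ c.lam) (hR : c.Rs < c.Rt)
    {T : Fin c.N → Set ℝ} (hT : ∀ n, MeasurableSet (T n)) :
    P ({ω | ∀ n, M.H n ω ∈ T n} ∩ M.outageᶜ)
      = P {ω | ∀ n, M.H n ω ∈ T n} * ENNReal.ofReal (Real.exp
          (-(c.N * c.K₁ * (c.betaE / c.p) ^ (-(2 / c.alpha)) * Real.exp (-(c.betaE / c.p))))) := by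
  have hb : 0 < c.betaE / c.p := div_pos (c.betaE_pos hR) hp
  have hΓ := Real.Gamma_pos_of_pos (show 0 < 2 / c.alpha + 1 by positivity)
  have hπ := Real.pi_pos
  rw [compl_outage_eq M hp, ← Set.ofPred_and, hM.measure_forall_H_mem_and_forall_S_mem hlam hT
    (fun n => c.measurable_gainThreshold c.betaE (c.node n.val)), hM.measure_forall_H_mem hT]
  simp_rw [c.lintegral_one_sub_expMeasure hα (c.betaE_pos hR) hp]
  rw [← ENNReal.ofReal_mul hlam, Finset.prod_const, expNeg_ofReal (by positivity),
    ← ENNReal.ofReal_pow (Real.exp_pos _).le, ← Real.exp_nat_mul, Finset.card_univ,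
    Fintype.card_fin, Params.K₁]
  congr 3; ring

/-- General `T` treats all cases at once: `Set.univ` for no conditioning and NOFT, half-lines for
OFT. -/
lemma IsModel.cond_real_outage [IsProbabilityMeasure P] (hM : M.IsModel P)
    (hα : 0 < c.alpha) (hp : 0 < c.p) (hlam : 0 ≤ c.lam) (hR : c.Rs < c.Rt)
    {T : Fin c.N → Set ℝ} (hT : ∀ n, MeasurableSet (T n)) (hT0 : ∀ n, expMeasure 1 (T n) ≠ 0) :
    (cond P {ω | ∀ n, M.H n ω ∈ T n}).real M.outage
      = 1 - Real.exp
          (-(c.N * c.K₁ * (c.betaE / c.p) ^ (-(2 / c.alpha)) * Real.exp (-(c.betaE / c.p)))) := by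
  have hpos : P {ω | ∀ n, M.H n ω ∈ T n} ≠ 0 := by
    rw [hM.measure_forall_H_mem hT]
    exact Finset.prod_ne_zero_iff.2 fun n _ => hT0 n
  have hTm : MeasurableSet {ω | ∀ n, M.H n ω ∈ T n} := by
    rw [Set.ofPred_forall]
    exact .iInter fun n => hM.measurable_H n (hT n)
  have := cond_isProbabilityMeasure hpos
  rw [← compl_compl M.outage, probReal_compl_eq_one_sub (hM.measurableSet_outage hp).compl,
    Measure.real, cond_apply hTm, hM.measure_inter_compl_outage hα hp hlam hR hT, ← mul_assoc,
    ENNReal.inv_mul_cancel hpos (measure_ne_top _ _), one_mul,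
    ENNReal.toReal_ofReal (Real.exp_pos _).le]

end Channels

end MultihopRaF

theorem theorem1 {Ω : Type*} [MeasurableSpace Ω] (P : Measure Ω) [IsProbabilityMeasure P]
    (c : MultihopRaF.Params) (hN : 1 ≤ c.N) (hL : 0 < c.L) (hα : 0 < c.alpha) (hp : 0 < c.p)
    (hlam : 0 < c.lam) (hR : c.Rs < c.Rt)
    (M : MultihopRaF.Channels c Ω) (hM : M.IsModel P) :
    P.real M.outage =
        1 - Real.exp (-(c.N * c.K₁ * (c.betaE / c.p) ^ (-(2 / c.alpha))
          * Real.exp (-(c.betaE / c.p)))) ∧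
      ∀ s : MultihopRaF.Scheme, MultihopRaF.secrecyOutageProb P M s =
        1 - Real.exp (-(c.N * c.K₁ * (c.betaE / c.p) ^ (-(2 / c.alpha))
          * Real.exp (-(c.betaE / c.p)))) := by
  have := isProbabilityMeasure_expMeasure one_pos
  have huniv := hM.cond_real_outage hα hp hlam.le hR (T := fun _ => Set.univ)
    (fun _ => .univ) (fun _ => by simp)
  simp only [Set.mem_univ, implies_true, Set.ofPred_true, cond_univ] at huniv
  refine ⟨huniv, fun s => ?_⟩
  cases s with
  | NOFT => simpa only [MultihopRaF.secrecyOutageProb, MultihopRaF.transmission, cond_univ]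
  | OFT =>
    have h := hM.cond_real_outage hα hp hlam.le hR
      (T := fun n => Set.Ioi (c.gainThreshold c.betaT (c.node n.val) (c.node (n.val + 1))))
      (fun _ => measurableSet_Ioi) (fun _ => MultihopRaF.expMeasure_Ioi_ne_zero _)
    simpa only [MultihopRaF.secrecyOutageProb, MultihopRaF.transmission,
      MultihopRaF.Channels.snrLegit, ← not_le, c.snr_le_iff hp, Set.mem_Ioi] using h
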